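/- For $i\in\{1,2\}$ let $X_i$ be a proper, smooth, geometrically connected curve over an arbitrary field $k_i$, with function field $K_i$ and set of closed points $\Sigma_{X_i}$. For $x\in\Sigma_{X_i}$ let $k(x)$ be the residue field at $x$, let $\operatorname{ord}_x$ be the normalized discrete valuation of $K_i$ at $x$ (with $\operatorname{ord}_x(0)=\infty$), and let $f(x)\in k(x)$ be the value at $x$ of a function $f\in K_i$ that is regular at $x$. Let $\iota:K_2^\times\to K_1^\times$ be an injective homomorphism of multiplicative groups, extended to $\iota:K_2\to K_1$ by $\iota(0)=0$. Let $\phi:\Sigma_{X_1}\to\Sigma_{X_2}$ be a map with finite fibers. For all $x_2\in\Sigma_{X_2}$ and $x_1\in\phi^{-1}(x_2)$ let $\iota_{x_1x_2}:k(x_2)^\times\to k(x_1)^\times$ be an injective homomorphism of multiplicative groups. Assume: 1. ($\iota$ is order-preserving with respect to $\phi$) for all $x_2\in\Sigma_{X_2}$ and $x_1\in\phi^{-1}(x_2)$ there is an integer $e_{x_1x_2}>0$ such that $\operatorname{ord}_{x_1}(\iota(f))=e_{x_1x_2}\operatorname{ord}_{x_2}(f)$ for all $f\in K_2$; 2. ($\iota$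 is value-preserving with respect to $\phi$ and $\{\iota_{x_1x_2}\}$) for all $f\in K_2^\times$, all $x_2\in\Sigma_{X_2}$ not in the support of $\operatorname{div}(f)$, and all $x_1\in\phi^{-1}(x_2)$, one has $\iota_{x_1x_2}(f(x_2))=\iota(f)(x_1)$; 3. the set $X_2(k_2)$ of $k_2$-rational points is infinite. Then $\iota:K_2\to K_1$ is additive, hence a homomorphism of fields. -/

import Mathlib

universe u v

namespace AnabelianCurve

open AlgebraicGeometry CategoryTheory

/-- A proper, smooth, geometrically connected curve over a field `k`: an integral scheme together
with a structure morphism to `Spec k` that is proper, smooth of relative dimension one and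
geometrically connected.  (Integrality is part of the meaning of "curve"; it makes the function
field available.) -/
structure Curve (k : Type u) [Field k] where
  /-- the underlying scheme -/
  X : Scheme.{u}
  /-- the structure morphism -/
  str : X ⟶ Spec (CommRingCat.of k)
  integral : IsIntegral X
  proper : IsProper str
  smooth : SmoothOfRelativeDimension 1 str
  geometricallyConnected : GeometricallyConnected str

namespace Curve

variable {k : Type u} [Field k] (C : Curve k)

instance : IsIntegral C.X := C.integral

instance : IsProper C.str := C.proper

/-- A curve is locally Noetherian, being of finite type over a field; this is what the order of
vanishing needs. -/
instance : IsLocallyNoetherian C.X := LocallyOfFiniteType.isLocallyNoetherian C.str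

/-- The function field `K` of the curve. -/
abbrev FunctionField : Type u := C.X.functionField

/-- The set of closed points of the curve. -/
abbrev ClosedPoint : Type u := closedPoints C.X

/-- The residue field `k(x)` at a closed point. -/
abbrev ResidueField (x : C.ClosedPoint) : Type u := C.X.residueField x.1

/-- The set `X(k)` of `k`-rational points: sections of the structure morphism. -/
abbrev RationalPoint : Type u :=
  {p : Spec (CommRingCat.of k) ⟶ C.X // p ≫ C.str = 𝟙 (Spec (CommRingCat.of k))}

/-- The order `ord_x f` at a closed point `x` of a nonzero rational function `f`. -/
noncomputable def ord (x : C.ClosedPoint) (f : C.FunctionFieldˣ) : ℤ :=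
  Scheme.ord (X := C.X) (f : C.FunctionField) x.1

open Classical in
/-- The value `f(x)` in the residue field `k(x)` of a rational function `f` at a closed point `x`.
It is the residue class of the unique element of the local ring at `x` that maps to `f`, if `f`
is regular at `x`, and `0` by convention if `f` is not regular at `x`. -/
noncomputable def value (x : C.ClosedPoint) (f : C.FunctionField) : C.ResidueField x :=
  if h : ∃ a : C.X.presheaf.stalk x.1,
      algebraMap (C.X.presheaf.stalk x.1) C.X.functionField a = f
  then (C.X.residue x.1).hom h.choose else 0

end Curve

open Classical in
/-- The extension of a map `ι : K₂ˣ → K₁ˣ` to a map `K₂ → K₁` by `0 ↦ 0`. -/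
noncomputable def extendByZero {K₂ : Type v} {K₁ : Type u} [Field K₂] [Field K₁]
    (ι : K₂ˣ →* K₁ˣ) (f : K₂) : K₁ :=
  if h : f = 0 then 0 else (ι (Units.mk0 f h) : K₁)

section

variable {k₁ : Type u} [Field k₁] {k₂ : Type v} [Field k₂] {X₁ : Curve k₁} {X₂ : Curve k₂}

/-- `ι` is order-preserving with respect to the map `φ` on closed points: for every closed
point `x₁` of `X₁`, with `x₂ = φ x₁`, there is a positive integer `e` with
`ord_{x₁} ∘ ι = e · ord_{x₂}`.  (On the zero function, both sides are `∞`.) -/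
def OrderPreserving (ι : X₂.FunctionFieldˣ →* X₁.FunctionFieldˣ)
    (φ : X₁.ClosedPoint → X₂.ClosedPoint) : Prop :=
  ∀ x₁ : X₁.ClosedPoint, ∃ e : ℤ, 0 < e ∧
    ∀ f : X₂.FunctionFieldˣ, X₁.ord x₁ (ι f) = e * X₂.ord (φ x₁) f

/-- `ι` is value-preserving with respect to `φ` and the maps `r x₁ : k(φ x₁)ˣ → k(x₁)ˣ`: for every
`f ∈ K₂ˣ` and every closed point `x₁` such that `φ x₁` is not in the support of `div f`, one has
`r x₁ (f(φ x₁)) = (ι f)(x₁)`.  The value `f(φ x₁)` is then nonzero; `h` only serves to view it as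
an element of `k(φ x₁)ˣ`. -/
def ValuePreserving (ι : X₂.FunctionFieldˣ →* X₁.FunctionFieldˣ)
    (φ : X₁.ClosedPoint → X₂.ClosedPoint)
    (r : ∀ x₁ : X₁.ClosedPoint, (X₂.ResidueField (φ x₁))ˣ →* (X₁.ResidueField x₁)ˣ) : Prop :=
  ∀ (f : X₂.FunctionFieldˣ) (x₁ : X₁.ClosedPoint), X₂.ord (φ x₁) f = 0 →
    ∀ h : X₂.value (φ x₁) f ≠ 0,
      (r x₁ (Units.mk0 (X₂.value (φ x₁) f) h) : X₁.ResidueField x₁) = X₁.value x₁ (ι f)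

end

end AnabelianCurve

/-! ### Additivity from compatibility with places: the abstract argument -/

namespace AnabelianCurve

open scoped WithZero
open PowerSeries

/-! Since the residue maps are injective, value preservation says that ι x ≡ 1 at x₁ exactly when x
≡ 1 at φ x₁. By multiplicativity, ι then respects congruences f ≡ b with b a constant, i.e.
algebraic over the base field. On X₁ a function without poles is constant, hence zero as soon as it
vanishes at one place.

For f nonconstant and b ≠ 0 constant put w = ι(f - b) / (ι f - ι b). If w has no poles, it is
constant; evaluation at a place where f takes the value s gives ι(s - b) = w (ι s - ι b) for every
constant s, and the infinitude of the constants forces w = 1 (`map_sub_one_const_of_div_le_one`). So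
ι(s - 1) = ι s - 1 on constants. A nonconstant x takes every constant value, so ι(x - 1) - (ι x - 1)
has infinitely many zeros and vanishes (`map_sub_one`); homogeneity gives additivity.

The crux is to choose f and b so that w has no poles. Poles can occur only at zeros of f - b, where
ι f - ι b might vanish to higher order than ι(f - b). A first derivative would settle this in
characteristic zero, but ι may be a Frobenius power, so a Hasse–Schmidt derivation (D_n) on K₁ is
used. Let n > 0 be least with D_n(ι(f - a)) ≠ 0 for some constant a, and replace f by f - a. For all
but finitely many b, D_n(ι f) is a unit at the zeros of f - b; as D_m(ι(f - b)) = 0 for 0 < m < n,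
the Leibniz rule excludes ι f - ι b = ι(f - b) u with u vanishing there (`div_le_one_of_coeff`). -/

/-- Compatibility of a multiplicative map `ι : K₂ → K₁` with families of valuations `v₁` and `v₂`
indexed by the same set: `ι` preserves integrality and principal units, `E ⊆ K₂` plays the role of
the field of constants, and `v₁` has the finiteness properties of the places of a complete curve. -/
structure PlaceCompatible {Q : Type*} {K₁ K₂ : Type*} [Field K₁] [Field K₂]
    (v₁ : Q → Valuation K₁ ℤᵐ⁰) (v₂ : Q → Valuation K₂ ℤᵐ⁰) (E : Subfield K₂)
    (ι : K₂ →*₀ K₁) : Prop where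
  map_le : ∀ q x, v₁ q (ι x) ≤ 1 ↔ v₂ q x ≤ 1
  map_sub_one_lt : ∀ q x, v₁ q (ι x - 1) < 1 ↔ v₂ q (x - 1) < 1
  const_le : ∀ x ∈ E, ∀ q, v₂ q x ≤ 1
  exists_zero : ∀ q, ∀ x ∉ E, v₂ q x ≤ 1 →
    ∃ y ≠ 0, v₂ q y < 1 ∧ ∀ q', v₂ q' x ≤ 1 → v₂ q' y ≤ 1
  inv_const : ∀ x : K₁, (∀ q, v₁ q x ≤ 1) → ∀ q, v₁ q x⁻¹ ≤ 1
  finite_ne_one : ∀ x : K₁, x ≠ 0 → {q | v₁ q x ≠ 1}.Finite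

/-- A Hasse–Schmidt derivation `Φ : K → K⟦X⟧` whose constants are exactly the elements integral at
all `v q`, and which preserves integrality at almost all `v q`. -/
structure HasseSchmidt {Q : Type*} {K : Type*} [Field K] (v : Q → Valuation K ℤᵐ⁰)
    (Φ : K →+* K⟦X⟧) : Prop where
  constantCoeff_apply : ∀ x, constantCoeff (Φ x) = x
  eq_C_iff : ∀ x, Φ x = C x ↔ ∀ q, v q x ≤ 1
  finite_not_integral : {q | ¬ ∀ x, v q x ≤ 1 → ∀ n, v q (coeff n (Φ x)) ≤ 1}.Finite

/-- At s = 0 the relation reads ι(-1) = -w, so w = ±1. If w = -1, injectivity forces characteristic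
2 on K₂, and comparing s with s², where s² - 1 = (s - 1)², gives 2 ι s (ι s - 1) = 0: either -1 = 1
in K₁, or E has at most two elements. -/
theorem eq_one_of_map_sub_one {K₁ K₂ : Type*} [Field K₁] [Field K₂] (ι : K₂ →*₀ K₁)
    (hι : Function.Injective ι) (E : Subfield K₂) [Infinite E] (w : K₁)
    (h : ∀ s ∈ E, ι (s - 1) = w * (ι s - 1)) : w = 1 := by
  have h0 : ι (-1) = -w := by simpa using h 0 E.zero_mem
  have hsq : w * w = 1 := by
    have : ι (-1) * ι (-1) = 1 := by rw [← map_mul]; simp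
    simpa [h0] using this
  rcases mul_self_eq_one_iff.mp hsq with hw | hw
  · exact hw
  have h1 : (-1 : K₂) = 1 := hι (by rw [h0, hw]; simp)
  have h2 : (2 : K₂) = 0 := by linear_combination -h1
  by_contra hne
  have h21 : (2 : K₁) ≠ 0 := fun h2' => hne (by rw [hw]; linear_combination -h2')
  have key : ∀ s ∈ E, s = 0 ∨ s = 1 := by
    intro s hs
    have e1 := h s hs
    have e2 := h (s * s) (E.mul_mem hs hs)
    have e3 : s * s - 1 = (s - 1) * (s - 1) := by linear_combination (s - 1) * h2
    rw [e3, map_mul, e1, map_mul, hw] at e2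
    have : 2 * (ι s * (ι s - 1)) = 0 := by linear_combination e2
    rcases mul_eq_zero.mp ((mul_eq_zero.mp this).resolve_left h21) with h | h
    · exact Or.inl (by simpa using h)
    · exact Or.inr (hι (by simpa [sub_eq_zero] using h))
  have hfin : (E : Set K₂).Finite := (Set.toFinite {0, 1}).subset fun s hs => by
    simpa using key s hs
  exact (Set.infinite_coe_iff.mp (inferInstance : Infinite E)) hfin

theorem not_inv_le_one_iff {K : Type*} [Field K] (v : Valuation K ℤᵐ⁰) {x : K} (hx : x ≠ 0) :
    ¬ v x⁻¹ ≤ 1 ↔ v x < 1 := by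
  have : 0 < v x := zero_lt_iff.mpr ((v.ne_zero_iff).mpr hx)
  rw [map_inv₀, inv_le_one₀ this, not_le]

namespace PlaceCompatible

variable {Q : Type*} {K₁ K₂ : Type*} [Field K₁] [Field K₂]
  {v₁ : Q → Valuation K₁ ℤᵐ⁰} {v₂ : Q → Valuation K₂ ℤᵐ⁰} {E : Subfield K₂} {ι : K₂ →*₀ K₁}

theorem map_lt (H : PlaceCompatible v₁ v₂ E ι) (q : Q) (x : K₂) :
    v₁ q (ι x) < 1 ↔ v₂ q x < 1 := by
  rcases eq_or_ne x 0 with rfl | hx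
  · simp
  rw [← not_inv_le_one_iff _ hx, ← not_inv_le_one_iff _ ((map_ne_zero ι).mpr hx), ← map_inv₀,
    H.map_le]

theorem map_eq_one (H : PlaceCompatible v₁ v₂ E ι) {q : Q} {x : K₂} (hx : v₂ q x = 1) :
    v₁ q (ι x) = 1 :=
  le_antisymm ((H.map_le q x).mpr hx.le) (not_lt.mp fun h => ((H.map_lt q x).mp h).ne hx)

/-- Division by the unit y turns the congruence x ≡ y into x / y ≡ 1, which ι respects by
hypothesis. -/
theorem map_sub_lt (H : PlaceCompatible v₁ v₂ E ι) {q : Q} (x : K₂) {y : K₂} (hy : v₂ q y = 1) :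
    v₁ q (ι x - ι y) < 1 ↔ v₂ q (x - y) < 1 := by
  have hy0 : y ≠ 0 := by rintro rfl; simp at hy
  have e2 : x - y = y * (x / y - 1) := by field_simp
  have e1 : ι x - ι y = ι y * (ι (x / y) - 1) := by
    have := (map_ne_zero ι).mpr hy0
    rw [map_div₀]; field_simp
  rw [e1, e2, map_mul, map_mul, hy, H.map_eq_one hy, one_mul, one_mul, H.map_sub_one_lt]

theorem const_eq_one (H : PlaceCompatible v₁ v₂ E ι) {b : K₂} (hb : b ∈ E) (hb0 : b ≠ 0) (q : Q) :
    v₂ q b = 1 := by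
  refine le_antisymm (H.const_le b hb q) (not_lt.mp fun h => ?_)
  exact (not_inv_le_one_iff _ hb0).mpr h (H.const_le _ (E.inv_mem hb) q)

theorem map_sub_const_lt (H : PlaceCompatible v₁ v₂ E ι) (q : Q) (x : K₂) {b : K₂} (hb : b ∈ E) :
    v₁ q (ι x - ι b) < 1 ↔ v₂ q (x - b) < 1 := by
  rcases eq_or_ne b 0 with rfl | hb0
  · simpa using H.map_lt q x
  · exact H.map_sub_lt x (H.const_eq_one hb hb0 q)

/-- This is how identities between constants of K₁ are checked at a single place. -/
theorem eq_zero_of_const (H : PlaceCompatible v₁ v₂ E ι) {h : K₁} (hc : ∀ q, v₁ q h ≤ 1) {q : Q}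
    (hq : v₁ q h < 1) : h = 0 := by
  by_contra h0
  exact (not_inv_le_one_iff _ h0).mpr hq (H.inv_const h hc q)

/-- If ι x had no poles, take y, a nonzero polynomial in x vanishing at one place: ι y would have no
poles but a zero, so ι y = 0. -/
theorem exists_not_le [Nonempty Q] (H : PlaceCompatible v₁ v₂ E ι) {x : K₂} (hx : x ∉ E) :
    ∃ q, ¬ v₁ q (ι x) ≤ 1 := by
  by_contra! h
  obtain ⟨q⟩ := ‹Nonempty Q›
  obtain ⟨y, hy0, hy, hy'⟩ := H.exists_zero q x hx ((H.map_le q x).mp (h q))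
  have := H.eq_zero_of_const (h := ι y)
    (fun q' => (H.map_le q' y).mpr (hy' q' ((H.map_le q' x).mp (h q')))) ((H.map_lt q y).mpr hy)
  exact hy0 (by simpa using this)

/-- Apply `exists_not_le` to (x - b)⁻¹. The zero found is indexed by Q, so it lies below a place of
K₁ without any surjectivity on places. -/
theorem exists_sub_lt [Nonempty Q] (H : PlaceCompatible v₁ v₂ E ι) {x : K₂} (hx : x ∉ E)
    {b : K₂} (hb : b ∈ E) : ∃ q, v₂ q (x - b) < 1 := by
  have h1 : x - b ∉ E := fun h => hx (by simpa using E.add_mem h hb)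
  have h0 : x - b ≠ 0 := fun h => h1 (h ▸ E.zero_mem)
  have h2 : (x - b)⁻¹ ∉ E := fun h => h1 (by simpa using E.inv_mem h)
  obtain ⟨q, hq⟩ := H.exists_not_le h2
  rw [H.map_le] at hq
  exact ⟨q, (not_inv_le_one_iff _ h0).mp hq⟩

theorem const_unique (H : PlaceCompatible v₁ v₂ E ι) {x b b' : K₂} {q : Q} (hb : b ∈ E)
    (hb' : b' ∈ E) (h : v₂ q (x - b) < 1) (h' : v₂ q (x - b') < 1) : b = b' := by
  by_contra hne
  have h1 := H.const_eq_one (E.sub_mem hb hb') (sub_ne_zero.mpr hne) q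
  have e : b - b' = (x - b') - (x - b) := by ring
  have := Valuation.map_sub_lt (v₂ q) h' h
  rw [← e, h1] at this
  exact lt_irrefl _ this

theorem sub_ne_zero [Nonempty Q] (H : PlaceCompatible v₁ v₂ E ι) {x : K₂} (hx : x ∉ E)
    {b : K₂} (hb : b ∈ E) : ι x - ι b ≠ 0 := by
  intro h
  obtain ⟨q, hq⟩ := H.exists_not_le hx
  rw [sub_eq_zero.mp h] at hq
  exact hq ((H.map_le q b).mpr (H.const_le b hb q))

/-- If `ι (f - b) / (ι f - ι b)` is integral over the zeros of `f - b`, it is integral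
everywhere. -/
theorem div_le_one [Nonempty Q] (H : PlaceCompatible v₁ v₂ E ι) {f : K₂} (hf : f ∉ E)
    {b : K₂} (hb : b ∈ E)
    (h : ∀ q, v₂ q (f - b) < 1 → v₁ q (ι (f - b) / (ι f - ι b)) ≤ 1) (q : Q) :
    v₁ q (ι (f - b) / (ι f - ι b)) ≤ 1 := by
  have hb1 : v₁ q (ι b) ≤ 1 := (H.map_le q b).mpr (H.const_le b hb q)
  by_cases hq : v₂ q f ≤ 1
  · by_cases hfb : v₂ q (f - b) < 1
    · exact h q hfb
    · have hle : v₂ q (f - b) ≤ 1 :=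
        (Valuation.map_sub _ _ _).trans (max_le hq (H.const_le b hb q))
      have e1 : v₁ q (ι (f - b)) = 1 := H.map_eq_one (le_antisymm hle (not_lt.mp hfb))
      have e2 : 1 ≤ v₁ q (ι f - ι b) := not_lt.mp fun h' => hfb ((H.map_sub_const_lt q f hb).mp h')
      rw [map_div₀, e1, one_div]
      exact inv_le_one_of_one_le₀ e2
  · have hq1 : 1 < v₁ q (ι f) := not_le.mp fun h' => hq ((H.map_le q f).mp h')
    have hf0 : f ≠ 0 := fun h0 => hf (h0 ▸ E.zero_mem)
    have hιf : ι f ≠ 0 := (map_ne_zero ι).mpr hf0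
    have e1 : v₁ q (ι f - ι b) = v₁ q (ι f) := by
      apply Valuation.map_sub_eq_of_lt_left
      exact hb1.trans_lt hq1
    -- At a pole of f, (f - b) / f is a principal unit, and ι preserves principal units.
    have e2 : v₁ q (ι ((f - b) / f) - 1) < 1 := by
      rw [H.map_sub_one_lt]
      have : (f - b) / f - 1 = - (b * f⁻¹) := by field_simp; ring
      rw [this, Valuation.map_neg, map_mul, map_inv₀]
      calc _ ≤ 1 * (v₂ q f)⁻¹ := mul_le_mul_left (H.const_le b hb q) _
        _ < 1 := by rw [one_mul]; exact inv_lt_one_of_one_lt₀ (not_le.mp hq)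
    have e3 : v₁ q (ι ((f - b) / f)) ≤ 1 := by
      have := Valuation.map_add (v₁ q) (ι ((f - b) / f) - 1) 1
      rw [sub_add_cancel, map_one] at this
      exact this.trans (max_le e2.le le_rfl)
    rwa [map_div₀, e1, ← map_div₀, ← map_div₀]

/-- Both sides of ι(s - b) = w (ι s - ι b) are constants, and they agree at a place where f takes
the value s. Replacing s by s b and cancelling ι b normalises b to 1. -/
theorem map_sub_one_const_of_div_le_one [Nonempty Q] [Infinite E] (H : PlaceCompatible v₁ v₂ E ι)
    (hι : Function.Injective ι) {f : K₂} (hf : f ∉ E) {b : K₂} (hb : b ∈ E) (hb0 : b ≠ 0)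
    (hw : ∀ q, v₁ q (ι (f - b) / (ι f - ι b)) ≤ 1) {s : K₂} (hs : s ∈ E) :
    ι (s - 1) = ι s - 1 := by
  set w := ι (f - b) / (ι f - ι b) with hwdef
  have hmul : ι (f - b) = w * (ι f - ι b) := (div_mul_cancel₀ _ (H.sub_ne_zero hf hb)).symm
  have c1 : ∀ x ∈ E, ∀ q, v₁ q (ι x) ≤ 1 := fun x hx q => (H.map_le q x).mpr (H.const_le x hx q)
  have key : ∀ s ∈ E, ι (s - b) = w * (ι s - ι b) := by
    intro s hs
    obtain ⟨q, hq⟩ := H.exists_sub_lt hf hs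
    have h1 := (H.map_sub_const_lt q f hs).mpr hq
    have h2 : v₁ q (ι (f - b) - ι (s - b)) < 1 :=
      (H.map_sub_const_lt q (f - b) (E.sub_mem hs hb)).mpr (by simpa using hq)
    rw [← sub_eq_zero]
    refine H.eq_zero_of_const (q := q) (fun q' => ?_) ?_
    · refine (Valuation.map_sub _ _ _).trans (max_le (c1 _ (E.sub_mem hs hb) q') ?_)
      rw [map_mul]
      exact mul_le_one' (hw q') ((Valuation.map_sub _ _ _).trans (max_le (c1 s hs q') (c1 b hb q')))
    · have e : ι (s - b) - w * (ι s - ι b) = w * (ι f - ι s) - (ι (f - b) - ι (s - b)) := by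
        rw [hmul]; ring
      rw [e]
      refine Valuation.map_sub_lt _ ?_ h2
      rw [map_mul]
      exact mul_lt_one_of_nonneg_of_lt_one_right (hw q) zero_le h1
  have key' : ∀ s ∈ E, ι (s - 1) = w * (ι s - 1) := by
    intro s hs
    have h := key (s * b) (E.mul_mem hs hb)
    have hb1 : ι b ≠ 0 := (map_ne_zero ι).mpr hb0
    have e : s * b - b = (s - 1) * b := by ring
    rw [e, map_mul, map_mul] at h
    apply mul_right_cancel₀ hb1
    linear_combination h
  rw [key' s hs, eq_one_of_map_sub_one ι hι E w key', one_mul]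

/-- The comparison of Hasse–Schmidt orders at a zero of `f - b`. -/
theorem div_le_one_of_coeff {Φ : K₁ →+* K₁⟦X⟧} (hc : ∀ x, constantCoeff (Φ x) = x) {F G c : K₁}
    {v : Valuation K₁ ℤᵐ⁰} {n : ℕ} (hn : n ≠ 0) (hΦc : Φ c = C c)
    (hint : ∀ x, v x ≤ 1 → ∀ n, v (coeff n (Φ x)) ≤ 1) (hF : v (coeff n (Φ F)) = 1)
    (hG : ∀ m, m ≠ 0 → m < n → coeff m (Φ G) = 0) (hG1 : v G < 1) :
    v (G / (F - c)) ≤ 1 := by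
  by_contra hw
  set u := (G / (F - c))⁻¹ with hu
  have hw0 : G / (F - c) ≠ 0 := by rintro h; simp [h] at hw
  have hu1 : v u < 1 := by
    rw [← not_inv_le_one_iff _ (inv_ne_zero hw0), inv_inv]; exact hw
  have hG0 : G ≠ 0 := by rintro rfl; simp at hw0
  have hmul : F - c = G * u := by rw [hu, inv_div]; field_simp
  have h1 := congrArg (fun x => coeff n (Φ x)) hmul
  -- Leibniz expansion of the n-th coefficient of G u: the end terms contain G or u itself, the
  -- middle ones vanish by `hG`.
  simp only [map_sub, map_mul, hΦc, coeff_C, if_neg hn, sub_zero, coeff_mul] at h1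
  have h2 : v (coeff n (Φ F)) < 1 := by
    rw [h1]
    refine Valuation.map_sum_lt _ one_ne_zero ?_
    rintro ⟨i, j⟩ hij
    rw [Finset.HasAntidiagonal.mem_antidiagonal] at hij
    dsimp only at hij ⊢
    rw [map_mul]
    rcases eq_or_ne i 0 with rfl | hi
    · rw [coeff_zero_eq_constantCoeff_apply, hc]
      exact mul_lt_one_of_nonneg_of_lt_one_left zero_le hG1 (hint u hu1.le j)
    · rcases eq_or_ne j 0 with rfl | hj
      · rw [coeff_zero_eq_constantCoeff_apply, hc]
        exact mul_lt_one_of_nonneg_of_lt_one_right (hint G hG1.le i) zero_le hu1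
      · rw [hG i hi (by omega)]; simp
  exact h2.ne hF

theorem map_sub_one_const [Nonempty Q] [Infinite E] (H : PlaceCompatible v₁ v₂ E ι)
    (hι : Function.Injective ι) {Φ : K₁ →+* K₁⟦X⟧} (hΦ : HasseSchmidt v₁ Φ)
    {f : K₂} (hf : f ∉ E) {s : K₂} (hs : s ∈ E) : ι (s - 1) = ι s - 1 := by
  classical
  -- The order is minimised over all translates f - a at once, so that the lower coefficients still
  -- vanish for every g - b after f is replaced by g = f - a.
  have hex : ∃ n, n ≠ 0 ∧ ∃ a ∈ E, coeff n (Φ (ι (f - a))) ≠ 0 := by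
    obtain ⟨q, hq⟩ := H.exists_not_le hf
    have h1 : Φ (ι f) ≠ C (ι f) := fun h => hq ((hΦ.eq_C_iff _).mp h q)
    by_contra! h
    refine h1 (PowerSeries.ext fun n => ?_)
    rcases eq_or_ne n 0 with rfl | hn
    · simp [hΦ.constantCoeff_apply]
    · have := h n hn 0 E.zero_mem
      rw [sub_zero] at this
      rw [this, coeff_C, if_neg hn]
  obtain ⟨hn, a, ha, hna⟩ := Nat.find_spec hex
  set n := Nat.find hex with hndef
  have hmin : ∀ m, m ≠ 0 → m < n → ∀ b ∈ E, coeff m (Φ (ι (f - b))) = 0 := by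
    intro m hm hmn b hb
    have := Nat.find_min hex hmn
    push Not at this
    exact this hm b hb
  set g := f - a with hg
  have hgE : g ∉ E := fun h => hf (by simpa [hg] using E.add_mem h ha)
  let B : Set Q := {q | ¬ ∀ x, v₁ q x ≤ 1 → ∀ n, v₁ q (coeff n (Φ x)) ≤ 1} ∪
    {q | v₁ q (coeff n (Φ (ι g))) ≠ 1}
  have hB : B.Finite := hΦ.finite_not_integral.union (H.finite_ne_one _ hna)
  -- At each bad place g takes at most one constant value, so only finitely many b are excluded.
  have hS : ({0} ∪ ⋃ q ∈ B, {b | b ∈ E ∧ v₂ q (g - b) < 1}).Finite := by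
    refine (Set.finite_singleton _).union (hB.biUnion fun q _ => Set.Subsingleton.finite ?_)
    rintro b ⟨hb, h⟩ b' ⟨hb', h'⟩
    exact H.const_unique hb hb' h h'
  obtain ⟨b, hb, hbS⟩ := ((Set.infinite_coe_iff.mp (inferInstance : Infinite E)).sdiff hS).nonempty
  simp only [Set.mem_union, Set.mem_singleton_iff, Set.mem_iUnion, Set.mem_ofPred_eq, not_or,
    not_exists] at hbS
  refine H.map_sub_one_const_of_div_le_one hι hgE hb hbS.1
    (H.div_le_one hgE hb fun q hq => ?_) hs
  have hqB : q ∉ B := fun h => hbS.2 q h ⟨hb, hq⟩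
  simp only [B, Set.mem_union, Set.mem_ofPred_eq, not_or, not_not] at hqB
  refine div_le_one_of_coeff hΦ.constantCoeff_apply hn ?_ hqB.1 hqB.2 ?_ ((H.map_lt q _).mpr hq)
  · exact (hΦ.eq_C_iff _).mpr fun q' => (H.map_le q' b).mpr (H.const_le b hb q')
  · intro m hm hmn
    have e : g - b = f - (a + b) := by rw [hg]; ring
    rw [e]
    exact hmin m hm hmn _ (E.add_mem ha hb)

/-- At a place where x takes the constant value b, ι(x - 1) ≡ ι(b - 1) = ι b - 1 ≡ ι x - 1. Distinct
b give distinct places, too many zeros for a nonzero function. -/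
theorem map_sub_one [Nonempty Q] [Infinite E] (H : PlaceCompatible v₁ v₂ E ι)
    (hι : Function.Injective ι) {Φ : K₁ →+* K₁⟦X⟧} (hΦ : HasseSchmidt v₁ Φ)
    (hE : E ≠ ⊤) (x : K₂) : ι (x - 1) = ι x - 1 := by
  obtain ⟨f, hf⟩ : ∃ f, f ∉ E := by
    by_contra! h
    exact hE (eq_top_iff.mpr fun x _ => h x)
  by_cases hx : x ∈ E
  · exact H.map_sub_one_const hι hΦ hf hx
  by_contra hne
  have hfin := H.finite_ne_one _ (_root_.sub_ne_zero.mpr hne)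
  choose q hq using fun b : E => H.exists_sub_lt hx b.2
  have hinj : Function.Injective q := fun b b' h =>
    Subtype.ext (H.const_unique b.2 b'.2 (hq b) (h ▸ hq b'))
  refine Set.infinite_range_of_injective hinj (hfin.subset ?_)
  rintro _ ⟨b, rfl⟩
  refine ne_of_lt ?_
  have h1 := (H.map_sub_const_lt (q b) x b.2).mpr (hq b)
  have h2 : v₁ (q b) (ι (x - 1) - ι (b - 1)) < 1 :=
    (H.map_sub_const_lt (q b) (x - 1) (E.sub_mem b.2 E.one_mem)).mpr (by simpa using hq b)
  have e : ι (x - 1) - (ι x - 1) = (ι (x - 1) - ι (b - 1)) - (ι x - ι b) := by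
    rw [H.map_sub_one_const hι hΦ hf b.2]; ring
  rw [e]
  exact Valuation.map_sub_lt _ h2 h1

theorem map_add [Nonempty Q] [Infinite E] (H : PlaceCompatible v₁ v₂ E ι)
    (hι : Function.Injective ι) {Φ : K₁ →+* K₁⟦X⟧} (hΦ : HasseSchmidt v₁ Φ)
    (hE : E ≠ ⊤) (x y : K₂) : ι (x + y) = ι x + ι y := by
  have hsub := H.map_sub_one hι hΦ hE
  have hneg : ι (-1) = -1 := by simpa using hsub 0
  have hneg' : ∀ z, ι (-z) = - ι z := fun z => by
    rw [neg_eq_neg_one_mul, map_mul, hneg, neg_one_mul]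
  rcases eq_or_ne y 0 with rfl | hy
  · simp
  have h1 : ι (x / y + 1) = ι (x / y) + 1 := by
    have := hsub (-(x / y))
    rw [show -(x / y) - 1 = -(x / y + 1) by ring, hneg', hneg'] at this
    linear_combination -this
  have e : x + y = y * (x / y + 1) := by field_simp
  have hy' : ι y ≠ 0 := (map_ne_zero ι).mpr hy
  rw [e, map_mul, h1, map_div₀]
  field_simp

end PlaceCompatible

end AnabelianCurve

/-! ### Hasse–Schmidt derivations along an étale coordinate -/

namespace AnabelianCurve

open scoped WithZero nonZeroDivisors
open PowerSeries

theorem exists_lift_of_isAdicComplete {R A S : Type*} [CommRing R] [CommRing A] [CommRing S]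
    [Algebra R A] [Algebra.FormallySmooth R A] (ψ : R →+* S) (I : Ideal S) [IsAdicComplete I S]
    (f : A →+* S ⧸ I) (hf : f.comp (algebraMap R A) = (Ideal.Quotient.mk I).comp ψ) :
    ∃ g : A →+* S, (Ideal.Quotient.mk I).comp g = f ∧ g.comp (algebraMap R A) = ψ := by
  let := ψ.toAlgebra
  let f' : A →ₐ[R] S ⧸ I := { f with commutes' := fun r => RingHom.congr_fun hf r }
  obtain ⟨g, hg⟩ := Algebra.FormallySmooth.exists_mkₐ_comp_eq_of_isAdicComplete f'
  refine ⟨g.toRingHom, RingHom.ext fun x => ?_, RingHom.ext fun x => ?_⟩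
  · exact DFunLike.congr_fun hg x
  · exact g.commutes x

variable {k A : Type*} [Field k] [CommRing A] [Algebra (Polynomial k) A]

/-- The Hasse–Schmidt derivation along the coordinate of an algebra that is formally smooth over a
polynomial ring. -/
theorem exists_hasseSchmidt_ringHom [Algebra.FormallySmooth (Polynomial k) A] :
    ∃ Φ : A →+* A⟦X⟧, (∀ a, constantCoeff (Φ a) = a) ∧
      ∀ p : Polynomial k, Φ (algebraMap (Polynomial k) A p) =
        p.eval₂ ((C (R := A)).comp ((algebraMap (Polynomial k) A).comp Polynomial.C))
          (C (algebraMap (Polynomial k) A Polynomial.X) + X) := by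
  -- Translation p(t) ↦ p(t + X), which reduces modulo X to the structure map and so lifts to A by
  -- formal smoothness.
  let ψ : Polynomial k →+* A⟦X⟧ :=
    Polynomial.eval₂RingHom ((C (R := A)).comp ((algebraMap (Polynomial k) A).comp Polynomial.C))
      (C (algebraMap (Polynomial k) A Polynomial.X) + X)
  obtain ⟨g, hg1, hg2⟩ := exists_lift_of_isAdicComplete (A := A) ψ (Ideal.span {(X : A⟦X⟧)})
    ((Ideal.Quotient.mk _).comp C) (by
      refine Polynomial.ringHom_ext (fun a => ?_) ?_
      · simp [ψ]
      · have : Ideal.Quotient.mk (Ideal.span {(X : A⟦X⟧)}) X = 0 :=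
          Ideal.Quotient.eq_zero_iff_mem.mpr (Ideal.mem_span_singleton_self _)
        simp [ψ, this])
  refine ⟨g, fun a => ?_, fun p => RingHom.congr_fun hg2 p⟩
  have h1 := RingHom.congr_fun hg1 a
  rw [RingHom.comp_apply, RingHom.comp_apply, Ideal.Quotient.eq, Ideal.mem_span_singleton,
    X_dvd_iff, map_sub, constantCoeff_C, sub_eq_zero] at h1
  exact h1

variable {K : Type*} [Field K] [Algebra A K]

/-- A nonzero a in A has image with constant coefficient a, hence invertible in K⟦X⟧. -/
theorem exists_hasseSchmidt_extension [IsDomain A] [IsFractionRing A K] {Φ : A →+* A⟦X⟧} (hΦ : ∀ a, constantCoeff (Φ a) = a) :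
    ∃ Ψ : K →+* K⟦X⟧, (∀ x, constantCoeff (Ψ x) = x) ∧
      ∀ a, Ψ (algebraMap A K a) = PowerSeries.map (algebraMap A K) (Φ a) := by
  have hu : ∀ y : A⁰, IsUnit (((PowerSeries.map (algebraMap A K)).comp Φ) y) := by
    intro y
    rw [isUnit_iff_constantCoeff, isUnit_iff_ne_zero, RingHom.comp_apply]
    have : constantCoeff (PowerSeries.map (algebraMap A K) (Φ y)) = algebraMap A K y := by
      rw [← coeff_zero_eq_constantCoeff_apply, coeff_map, coeff_zero_eq_constantCoeff_apply, hΦ]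
    rw [this]
    exact IsLocalization.to_map_ne_zero_of_mem_nonZeroDivisors K le_rfl y.2
  refine ⟨IsLocalization.lift hu, fun x => ?_, fun a => IsLocalization.lift_eq hu a⟩
  have : (constantCoeff.comp (IsLocalization.lift hu : K →+* K⟦X⟧)) = RingHom.id K := by
    apply IsLocalization.ringHom_ext A⁰
    ext a
    simp only [RingHom.comp_apply, IsLocalization.lift_eq, RingHom.id_apply]
    rw [← coeff_zero_eq_constantCoeff_apply, coeff_map, coeff_zero_eq_constantCoeff_apply, hΦ]
  exact RingHom.congr_fun this x

/-- A Hasse–Schmidt derivation that is trivial on `k` is trivial on elements algebraic over `k`. -/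
theorem hasseSchmidt_eq_C_of_isAlgebraic {Ψ : K →+* K⟦X⟧} (hΨ : ∀ x, constantCoeff (Ψ x) = x)
    (σ : k →+* K) (hσ : ∀ c, Ψ (σ c) = C (σ c)) {c : K} {m : Polynomial k} (hm : m ≠ 0)
    (hc : m.eval₂ σ c = 0) : Ψ c = C c := by
  have hm' : m.map σ ≠ 0 := (Polynomial.map_ne_zero_iff σ.injective).mpr hm
  -- The element c may be inseparable, so the full power of T - c is split off; the cofactor cannot
  -- vanish at Ψ c, since it does not vanish at the constant coefficient c.
  obtain ⟨S, hS, hdvd⟩ := Polynomial.exists_eq_pow_rootMultiplicity_mul_and_not_dvd _ hm' c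
  have h0 : (m.map σ).eval₂ C (Ψ c) = 0 := by
    rw [Polynomial.eval₂_map, show (C (R := K)).comp σ = Ψ.comp σ from
      RingHom.ext fun x => (hσ x).symm, ← Polynomial.hom_eval₂, hc, map_zero]
  rw [hS, Polynomial.eval₂_mul, Polynomial.eval₂_pow, mul_eq_zero] at h0
  rcases h0 with h0 | h0
  · have := eq_zero_of_pow_eq_zero h0
    simpa [sub_eq_zero] using this
  · exfalso
    apply hdvd
    rw [Polynomial.dvd_iff_isRoot, Polynomial.IsRoot.def]
    have := congrArg (constantCoeff (R := K)) h0
    rw [Polynomial.hom_eval₂, hΨ, map_zero] at this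
    rw [← this, Polynomial.eval]
    congr 1

/-- If translation of the coordinate fixes an element algebraic over `k[t]`, that element is
algebraic over `k`. -/
theorem exists_eval₂_eq_zero_of_hasseSchmidt_eq_C {Ψ : K →+* K⟦X⟧} (τ : Polynomial k →+* K)
    (hτ : ∀ p : Polynomial k, Ψ (τ p) =
      p.eval₂ ((C (R := K)).comp (τ.comp Polynomial.C)) (C (τ Polynomial.X) + X))
    {x : K} (hx : Ψ x = C x) {p : Polynomial (Polynomial k)} (hp : p ≠ 0)
    (hpx : p.eval₂ τ x = 0) : ∃ m : Polynomial k, m ≠ 0 ∧ m.eval₂ (τ.comp Polynomial.C) x = 0 := by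
  set σ := τ.comp Polynomial.C with hσ
  have h1 : p.eval₂ (Ψ.comp τ) (C x) = 0 := by
    rw [← hx, ← Polynomial.hom_eval₂, hpx, map_zero]
  -- Translation is a Taylor shift, which is injective on K[T]; so p(T, x) = 0 with T an
  -- indeterminate, and each coefficient in T is a relation for x over k.
  have h2 : Ψ.comp τ = (Polynomial.coeToPowerSeries.ringHom).comp
      ((Polynomial.taylorAlgHom (τ Polynomial.X) : Polynomial K →+* Polynomial K).comp
        (Polynomial.mapRingHom σ)) := by
    refine Polynomial.ringHom_ext (fun a => ?_) ?_
    · simp [hτ]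
    · simp [hτ, add_comm]
  have h3 : p.eval₂ (Polynomial.mapRingHom σ) (Polynomial.C x) = 0 := by
    have hC : (C x : K⟦X⟧) = Polynomial.coeToPowerSeries.ringHom
        ((Polynomial.taylorAlgHom (τ Polynomial.X) : Polynomial K →+* Polynomial K)
          (Polynomial.C x)) := by simp
    rw [h2, hC, ← RingHom.comp_apply, ← RingHom.comp_assoc, ← Polynomial.hom_eval₂,
      RingHom.comp_apply] at h1
    have h1' := Polynomial.coe_injective K (by simpa using h1 :
      ((Polynomial.taylorAlgHom (τ Polynomial.X)
        (p.eval₂ (Polynomial.mapRingHom σ) (Polynomial.C x)) : Polynomial K) : K⟦X⟧) =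
        ((0 : Polynomial K) : K⟦X⟧))
    exact Polynomial.taylor_injective (τ Polynomial.X) (by simpa using h1')
  obtain ⟨i, hi⟩ : ∃ i, p.coeff i ≠ 0 := by
    by_contra! h
    exact hp (Polynomial.ext h)
  obtain ⟨j, hj⟩ : ∃ j, (p.coeff i).coeff j ≠ 0 := by
    by_contra! h
    exact hi (Polynomial.ext h)
  refine ⟨∑ l ∈ p.support, Polynomial.monomial l ((p.coeff l).coeff j), fun h => hj ?_, ?_⟩
  · have := congrArg (fun r => Polynomial.coeff r i) h
    simp only [Polynomial.finsetSum_coeff, Polynomial.coeff_monomial, Polynomial.coeff_zero,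
      Finset.sum_ite_eq', Polynomial.mem_support_iff] at this
    simpa [hi] using this
  · have := congrArg (fun r => Polynomial.coeff r j) h3
    simp only [Polynomial.eval₂_eq_sum, Polynomial.sum_def, Polynomial.finsetSum_coeff,
      ← Polynomial.C_pow, Polynomial.coeff_mul_C, Polynomial.coe_mapRingHom,
      Polynomial.coeff_map, Polynomial.coeff_zero] at this
    rw [Polynomial.eval₂_finsetSum]
    simpa [Polynomial.eval₂_monomial] using this

/-- The coefficients of the Hasse–Schmidt derivation are integral at a valuation whose valuation
ring is a localization of `A`. -/
theorem coeff_le_one_of_localization {Φ : A →+* A⟦X⟧} {Ψ : K →+* K⟦X⟧}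
    (hΨ : ∀ x, constantCoeff (Ψ x) = x)
    (hA : ∀ a, Ψ (algebraMap A K a) = PowerSeries.map (algebraMap A K) (Φ a))
    (v : Valuation K ℤᵐ⁰) (hv : ∀ a, v (algebraMap A K a) ≤ 1) {a s : A}
    (hs : v (algebraMap A K s) = 1) (n : ℕ) :
    v (coeff n (Ψ (algebraMap A K a / algebraMap A K s))) ≤ 1 := by
  have hs0 : algebraMap A K s ≠ 0 := by intro h; simp [h] at hs
  induction n using Nat.strong_induction_on with
  | _ n ih =>
    set y := Ψ (algebraMap A K a / algebraMap A K s) with hy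
    have hmul : Ψ (algebraMap A K a) = y * Ψ (algebraMap A K s) := by
      rw [hy, ← map_mul, div_mul_cancel₀ _ hs0]
    have h1 := congrArg (coeff n) hmul
    rw [coeff_mul, Finset.Nat.sum_antidiagonal_eq_sum_range_succ_mk, Finset.sum_range_succ,
      Nat.sub_self, coeff_zero_eq_constantCoeff_apply, hΨ, hA, coeff_map] at h1
    -- The product formula is solved for the top coefficient, whose factor s is a unit at v.
    have h2 : coeff n y * algebraMap A K s = algebraMap A K (coeff n (Φ a)) -
        ∑ l ∈ Finset.range n, coeff l y * coeff (n - l) (Ψ (algebraMap A K s)) := by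
      rw [h1]; ring
    have h3 : v (coeff n y * algebraMap A K s) ≤ 1 := by
      rw [h2]
      refine (Valuation.map_sub _ _ _).trans (max_le (hv _) (Valuation.map_sum_le _ ?_))
      intro l hl
      rw [map_mul, hA, coeff_map]
      exact mul_le_one' (ih l (Finset.mem_range.mp hl)) (hv _)
    rwa [map_mul, hs, mul_one] at h3

end AnabelianCurve

/-! ### Étale algebras over k[X] -/

namespace AnabelianCurve

open scoped Polynomial nonZeroDivisors

namespace EtaleChart

theorem isNoetherianRing (k A : Type*) [Field k] [CommRing A] [IsDomain A]
    [Algebra k[X] A] [Algebra.Etale k[X] A] : IsNoetherianRing A := Algebra.FiniteType.isNoetherianRing k[X] A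

/-- Comparable primes over the same prime of k[X] coincide by quasi-finiteness, and nonzero primes
of k[X] are maximal. -/
theorem isMaximal_of_ne_bot (k : Type*) {A : Type*} [Field k] [CommRing A] [IsDomain A]
    [Algebra k[X] A] [Algebra.Etale k[X] A]
    (q : Ideal A) [q.IsPrime] (hq : q ≠ ⊥) : q.IsMaximal := by
  have h1 : q.under k[X] ≠ ⊥ := fun h => hq
    (Algebra.QuasiFinite.eq_of_le_of_under_eq (R := k[X]) ⊥ q bot_le (by
      rw [h]
      exact Ideal.comap_bot_of_injective _ (FaithfulSMul.algebraMap_injective _ _))).symm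
  have h2 : (q.under k[X]).IsMaximal := Ring.DimensionLEOne.maximalOfPrime h1 inferInstance
  obtain ⟨m, hm, hqm⟩ := Ideal.exists_le_maximal q (Ideal.IsPrime.ne_top ‹_›)
  have h3 : q.under k[X] = m.under k[X] :=
    h2.eq_of_le (Ideal.IsPrime.ne_top inferInstance) (Ideal.comap_mono hqm)
  rwa [Algebra.QuasiFinite.eq_of_le_of_under_eq (R := k[X]) q m hqm h3]

/-- Otherwise A would be a field, finite over k by the Nullstellensatz, making the coordinate
algebraic over k. -/
theorem ne_bot_of_isMaximal (k : Type*) {A : Type*} [Field k] [CommRing A] [IsDomain A]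
    [Algebra k[X] A] [Algebra.Etale k[X] A]
    (q : Ideal A) [hq : q.IsMaximal] : q ≠ ⊥ := by
  rintro rfl
  let _ : Field A := (Ring.isField_iff_maximal_bot.mpr hq).toField
  let _ : Algebra k A := ((algebraMap k[X] A).comp Polynomial.C).toAlgebra
  have : IsScalarTower k k[X] A := IsScalarTower.of_algebraMap_eq fun _ => rfl
  have : Algebra.FiniteType k A := Algebra.FiniteType.trans (S := k[X]) inferInstance inferInstance
  have : Module.Finite k A := finite_of_finite_type_of_isJacobsonRing k A
  obtain ⟨p, hp, hpx⟩ := Algebra.IsIntegral.isIntegral (R := k) (algebraMap k[X] A Polynomial.X)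
  apply hp.ne_zero
  apply FaithfulSMul.algebraMap_injective k[X] A
  have h : algebraMap k[X] A = Polynomial.eval₂RingHom (algebraMap k A)
      (algebraMap k[X] A Polynomial.X) :=
    Polynomial.ringHom_ext (fun a => by simp [RingHom.algebraMap_toAlgebra]) (by simp)
  rw [map_zero, ← hpx]
  exact RingHom.congr_fun h p

/-- Unramifiedness: the maximal ideal is generated by that of the local ring of k[X] below, hence is
principal. -/
theorem isDiscreteValuationRing (k : Type*) {A : Type*} [Field k] [CommRing A] [IsDomain A]
    [Algebra k[X] A] [Algebra.Etale k[X] A]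
    (q : Ideal A) [q.IsMaximal] (O : Type*) [CommRing O] [IsDomain O]
    [Algebra A O] [IsLocalization.AtPrime O q] : IsDiscreteValuationRing O := by
  have := isNoetherianRing k A
  let p := q.under k[X]
  let := Localization.AtPrime.algebraOfLiesOver p q
  have hmap := ((Algebra.isUnramifiedAt_iff_map_eq k[X] p q).mp inferInstance).2
  have : IsLocalRing O := IsLocalization.AtPrime.isLocalRing O q
  have : IsNoetherianRing O := IsLocalization.isNoetherianRing q.primeCompl O inferInstance
  have hpr : (IsLocalRing.maximalIdeal (Localization.AtPrime q)).IsPrincipal := by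
    rw [← hmap]; infer_instance
  have hDVR : IsDiscreteValuationRing (Localization.AtPrime q) :=
    ((IsDiscreteValuationRing.TFAE (Localization.AtPrime q)
      (IsLocalization.AtPrime.not_isField A (ne_bot_of_isMaximal k q) _)).out 4 0).mp hpr
  exact IsDiscreteValuationRing.RingEquivClass.isDiscreteValuationRing
    (IsLocalization.algEquiv q.primeCompl (Localization.AtPrime q) O).toRingEquiv

theorem exists_eval₂_eq_zero {k A : Type*} [Field k] [CommRing A] [IsDomain A]
    [Algebra k[X] A] [Algebra.Etale k[X] A]
    {K : Type*} [Field K] [Algebra A K] [IsFractionRing A K] (x : K) :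
    ∃ p : k[X][X], p ≠ 0 ∧ p.eval₂ ((algebraMap A K).comp (algebraMap k[X] A)) x = 0 := by
  let _ : Algebra k[X] K := ((algebraMap A K).comp (algebraMap k[X] A)).toAlgebra
  have : IsScalarTower k[X] A K := IsScalarTower.of_algebraMap_eq fun _ => rfl
  have hinj : Function.Injective (algebraMap k[X] K) :=
    (IsFractionRing.injective A K).comp (FaithfulSMul.algebraMap_injective _ _)
  have : FaithfulSMul k[X] K := (faithfulSMul_iff_algebraMap_injective _ _).mpr hinj
  let F := FractionRing k[X]
  let _ : Algebra F K := FractionRing.liftAlgebra k[X] K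
  have : IsScalarTower k[X] F K := inferInstance
  have : Algebra.FormallyUnramified A K := Algebra.FormallyUnramified.of_isLocalization A⁰
  have : Algebra.FormallyUnramified k[X] K := Algebra.FormallyUnramified.comp k[X] A K
  have : Algebra.FormallyUnramified F K := Algebra.FormallyUnramified.of_restrictScalars k[X] F K
  have : Algebra.EssFiniteType A K := Algebra.EssFiniteType.of_isLocalization K A⁰
  have : Algebra.EssFiniteType k[X] K := Algebra.EssFiniteType.comp k[X] A K
  have : Algebra.EssFiniteType F K := Algebra.EssFiniteType.of_comp k[X] F K
  have : Module.Finite F K := Algebra.FormallyUnramified.finite_of_free F K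
  have : Algebra.IsAlgebraic F K := inferInstance
  have : Algebra.IsAlgebraic k[X] K := (IsFractionRing.comap_isAlgebraic_iff (K := F)).mpr this
  exact Algebra.IsAlgebraic.isAlgebraic (R := k[X]) x

end EtaleChart

end AnabelianCurve

namespace AnabelianCurve

open AlgebraicGeometry CategoryTheory
open scoped Polynomial nonZeroDivisors WithZero

namespace EtaleChart

/-- Residue fields of an étale chart at maximal ideals are algebraic over the base field. -/
theorem exists_eval₂_mem_maximalIdeal (k : Type*) {A : Type*} [Field k] [CommRing A]
    [Algebra k[X] A] [Algebra.Etale k[X] A] (q : Ideal A) [q.IsMaximal]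
    (O : Type*) [CommRing O] [Algebra A O] [IsLocalization.AtPrime O q] [IsLocalRing O] (f : O) :
    ∃ p : k[X], p ≠ 0 ∧ p.eval₂ ((algebraMap A O).comp ((algebraMap k[X] A).comp Polynomial.C)) f ∈
      IsLocalRing.maximalIdeal O := by
  let _ : Field (A ⧸ q) := Ideal.Quotient.field q
  let _ : Algebra k A := ((algebraMap k[X] A).comp Polynomial.C).toAlgebra
  have : IsScalarTower k k[X] A := IsScalarTower.of_algebraMap_eq fun _ => rfl
  have : Algebra.FiniteType k A := Algebra.FiniteType.trans (S := k[X]) inferInstance inferInstance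
  have : Algebra.FiniteType k (A ⧸ q) := inferInstance
  have : Module.Finite k (A ⧸ q) := finite_of_finite_type_of_isJacobsonRing k (A ⧸ q)
  let e := IsLocalization.AtPrime.equivQuotMaximalIdeal q O
  obtain ⟨p, hp, hpx⟩ := Algebra.IsIntegral.isIntegral (R := k) (e.symm (Ideal.Quotient.mk _ f))
  refine ⟨p, hp.ne_zero, ?_⟩
  rw [← Ideal.Quotient.eq_zero_iff_mem, Polynomial.hom_eval₂, ← map_zero (e : A ⧸ q →+* _), ← hpx,
    Polynomial.hom_eval₂]
  congr 1
  simp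

end EtaleChart

/-! ### Charts, closed points and valuations of a curve -/

namespace Curve

variable {k : Type u} [Field k] (C : Curve k)

/-- The constants, as global functions on the curve. -/
noncomputable def globalConst : k →+* Γ(C.X, ⊤) :=
  C.str.appTop.hom.comp (Scheme.ΓSpecIso (CommRingCat.of k)).inv.hom

/-- The constants, as rational functions on the curve. -/
noncomputable def const : k →+* C.FunctionField :=
  (C.X.presheaf.germ ⊤ (genericPoint C.X) trivial).hom.comp C.globalConst

theorem exists_chart (x : C.X) : ∃ (V : C.X.Opens), IsAffineOpen V ∧ x ∈ V ∧
    ∃ g : k[X] →+* Γ(C.X, V), g.Etale ∧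
      g.comp Polynomial.C = (C.X.presheaf.map (homOfLE le_top).op).hom.comp C.globalConst := by
  obtain ⟨U, hU, V, hV, hx, e, hf⟩ :=
    C.smooth.exists_isStandardSmoothOfRelativeDimension x
  obtain rfl : U = ⊤ := by
    ext y
    have h1 : C.str x ∈ U := e hx
    have h2 : y = C.str x := Subsingleton.elim (α := PrimeSpectrum k) _ _
    simp [h2, h1]
  refine ⟨V, hV, hx, ?_⟩
  obtain ⟨g, hg, hge⟩ := hf.exists_etale_mvPolynomial
  let i : k ≃+* Γ(Spec (CommRingCat.of k), ⊤) :=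
    (Scheme.ΓSpecIso (CommRingCat.of k)).symm.commRingCatIsoToRingEquiv
  let j : k[X] ≃+* MvPolynomial (Fin 1) Γ(Spec (CommRingCat.of k), ⊤) :=
    ((MvPolynomial.uniqueAlgEquiv k (Fin 1)).symm.toRingEquiv).trans
      (MvPolynomial.mapEquiv (Fin 1) i)
  refine ⟨g.comp j.toRingHom, RingHom.Etale.respectsIso.2 _ _ hge, ?_⟩
  ext a
  have hj : j (Polynomial.C a) = MvPolynomial.C (i a) := by
    simp [j]
  have := RingHom.congr_fun hg (i a)
  simp only [RingHom.comp_apply] at this ⊢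
  change g (j (Polynomial.C a)) = _
  rw [hj, this]
  simp only [Scheme.Hom.appLE, globalConst]
  rfl

instance : JacobsonSpace C.X := LocallyOfFiniteType.jacobsonSpace C.str

instance : IsNoetherian C.X where
  toCompactSpace := (quasiCompact_iff_compactSpace C.str).mp inferInstance

theorem isClosed_singleton_of_ne_genericPoint {x : C.X} (hx : x ≠ genericPoint C.X) :
    IsClosed ({x} : Set C.X) := by
  obtain ⟨V, hV, hxV, g, hg, -⟩ := C.exists_chart x
  have : Nonempty V := ⟨⟨x, hxV⟩⟩
  algebraize [g]
  have hq : (hV.primeIdealOf ⟨x, hxV⟩).asIdeal ≠ ⊥ := by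
    intro h
    apply hx
    have h1 : hV.primeIdealOf ⟨x, hxV⟩ = ⊥ := PrimeSpectrum.ext h
    have h2 := h1.trans ((genericPoint_eq_bot_of_affine _).symm.trans
      hV.primeIdealOf_genericPoint.symm)
    exact (hV.fromSpec_primeIdealOf ⟨x, hxV⟩).symm.trans
      ((congrArg hV.fromSpec h2).trans (hV.fromSpec_primeIdealOf _))
  have hmax := EtaleChart.isMaximal_of_ne_bot k _ hq
  let y : Spec Γ(C.X, V) := hV.primeIdealOf ⟨x, hxV⟩
  have hcl : IsClosed {y} := (hV.primeIdealOf ⟨x, hxV⟩).isClosed_singleton_iff_isMaximal.mpr hmax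
  apply isClosed_singleton_of_isLocallyClosed_singleton
  have : ({x} : Set C.X) = hV.fromSpec '' {y} :=
    Set.image_singleton.trans (congrArg _ (hV.fromSpec_primeIdealOf ⟨x, hxV⟩)) |>.symm
  rw [this]
  exact hcl.isLocallyClosed.image hV.fromSpec.isOpenEmbedding.isInducing
    hV.fromSpec.isOpenEmbedding.isOpen_range.isLocallyClosed

/-- There are finitely many irreducible components by noetherianity, and the generic point of each
is not that of the curve, hence closed. -/
theorem finite_of_isClosed {Z : Set C.X} (hZ : IsClosed Z) (hη : genericPoint C.X ∉ Z) :
    Z.Finite := by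
  obtain ⟨S, hSf, hSc, hSi, rfl⟩ :=
    TopologicalSpace.NoetherianSpace.exists_finite_set_isClosed_irreducible hZ
  refine hSf.sUnion fun T hT => ?_
  obtain ⟨z, hz⟩ := QuasiSober.sober (hSi T hT) (hSc T hT)
  have hzT : z ∈ T := hz.mem
  have hzη : z ≠ genericPoint C.X := by
    rintro rfl
    exact hη ⟨T, hT, hzT⟩
  have := C.isClosed_singleton_of_ne_genericPoint hzη
  rw [← hz.def, this.closure_eq]
  exact Set.finite_singleton z

theorem finite_closedPoint_notMem (U : C.X.Opens) [hU : Nonempty U] :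
    {x : C.ClosedPoint | x.1 ∉ U}.Finite := by
  refine Set.Finite.preimage (f := Subtype.val) (s := (U : Set C.X)ᶜ)
    (Subtype.val_injective.injOn) (C.finite_of_isClosed U.isOpen.isClosed_compl ?_)
  simpa using ((genericPoint_spec C.X).mem_open_set_iff U.isOpen).mpr
    (by simpa using hU)

instance (x : C.ClosedPoint) : IsDiscreteValuationRing (C.X.presheaf.stalk x.1) := by
  obtain ⟨V, hV, hxV, g, hg, -⟩ := C.exists_chart x.1
  have : Nonempty V := ⟨⟨x.1, hxV⟩⟩
  algebraize [g]
  have := hV.primeIdealOf_isMaximal_of_isClosed ⟨x.1, hxV⟩ x.2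
  let _ : Algebra Γ(C.X, V) (C.X.presheaf.stalk x.1) := (C.X.presheaf.germ V x.1 hxV).hom.toAlgebra
  have : IsLocalization.AtPrime (C.X.presheaf.stalk x.1) (hV.primeIdealOf ⟨x.1, hxV⟩).asIdeal :=
    hV.isLocalization_stalk ⟨x.1, hxV⟩
  exact EtaleChart.isDiscreteValuationRing k (hV.primeIdealOf ⟨x.1, hxV⟩).asIdeal _

instance : Nonempty C.ClosedPoint := by
  obtain ⟨x, -, hx⟩ := nonempty_inter_closedPoints (X := C.X) Set.univ_nonempty
    isClosed_univ.isLocallyClosed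
  exact ⟨⟨x, hx⟩⟩

/-- The valuation of the function field at a closed point. -/
noncomputable def valuation (x : C.ClosedPoint) : Valuation C.FunctionField ℤᵐ⁰ :=
  (IsDiscreteValuationRing.maximalIdeal (C.X.presheaf.stalk x.1)).valuation C.FunctionField

theorem valuation_le_one_iff {x : C.ClosedPoint} {f : C.FunctionField} :
    C.valuation x f ≤ 1 ↔
      ∃ a, algebraMap (C.X.presheaf.stalk x.1) C.X.functionField a = f := by
  refine ⟨IsDiscreteValuationRing.exists_lift_of_le_one, ?_⟩
  rintro ⟨a, rfl⟩
  exact IsDedekindDomain.HeightOneSpectrum.valuation_le_one _ a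

theorem valuation_algebraMap_lt_one_iff {x : C.ClosedPoint} {a : C.X.presheaf.stalk x.1} :
    C.valuation x (algebraMap (C.X.presheaf.stalk x.1) C.X.functionField a) < 1 ↔
      a ∈ IsLocalRing.maximalIdeal (C.X.presheaf.stalk x.1) :=
  IsDedekindDomain.HeightOneSpectrum.valuation_lt_one_iff_mem _ a

theorem ord_eq_iff {x : C.ClosedPoint} {f : C.FunctionFieldˣ} {n : ℤ} :
    C.ord x f = n ↔ (C.valuation x f)⁻¹ = WithZero.exp n := by
  have hx : Order.coheight x.1 = 1 := by
    have h1 := ringKrullDim_stalk_eq_coheight x.1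
    rw [IsDiscreteValuationRing.ringKrullDim_eq_one] at h1
    exact_mod_cast h1.symm
  rw [ord, Scheme.ord_eq_iff hx f.ne_zero, Scheme.ordHom, Ring.ordFrac_eq_valuation_inv]
  rfl

theorem valuation_eq_exp (x : C.ClosedPoint) (f : C.FunctionFieldˣ) :
    C.valuation x f = WithZero.exp (-C.ord x f) := by
  rw [WithZero.exp_neg, ← C.ord_eq_iff.mp rfl, inv_inv]

end Curve
end AnabelianCurve

/-! ### Constants, and the Hasse–Schmidt derivation of a function field -/

namespace AnabelianCurve

open AlgebraicGeometry CategoryTheory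
open scoped Polynomial nonZeroDivisors WithZero

namespace Curve

variable {k : Type u} [Field k] (C : Curve k)

/-- The constants, as elements of the local ring at a point. -/
noncomputable def constStalk (x : C.X) : k →+* C.X.presheaf.stalk x :=
  (C.X.presheaf.germ ⊤ x trivial).hom.comp C.globalConst

theorem algebraMap_constStalk (x : C.X) (c : k) :
    algebraMap (C.X.presheaf.stalk x) C.X.functionField (C.constStalk x c) = C.const c := by
  have : Nonempty (⊤ : C.X.Opens) := ⟨⟨x, trivial⟩⟩
  exact Scheme.algebraMap_germ_eq_germToFunctionField C.X (U := ⊤) trivial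
    (C.globalConst c)

theorem germ_const {V : C.X.Opens} {x : C.X} (hx : x ∈ V) (c : k) :
    C.X.presheaf.germ V x hx ((C.X.presheaf.map (homOfLE le_top).op).hom (C.globalConst c)) =
      C.constStalk x c :=
  C.X.presheaf.germ_res_apply (homOfLE le_top) x hx (C.globalConst c)

theorem valuation_const_le_one (x : C.ClosedPoint) (c : k) : C.valuation x (C.const c) ≤ 1 :=
  C.valuation_le_one_iff.mpr ⟨_, C.algebraMap_constStalk x.1 c⟩

/-- The subfield of rational functions that are algebraic over the base field. -/
noncomputable def constants : Subfield C.FunctionField :=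
  letI := C.const.toAlgebra
  (algebraicClosure k C.FunctionField).toSubfield

theorem mem_constants_iff {f : C.FunctionField} :
    f ∈ C.constants ↔ ∃ p : k[X], p ≠ 0 ∧ p.eval₂ C.const f = 0 := by
  let := C.const.toAlgebra
  exact mem_algebraicClosure_iff

theorem mem_constants_iff_isIntegralElem {f : C.FunctionField} :
    f ∈ C.constants ↔ C.const.IsIntegralElem f := by
  let := C.const.toAlgebra
  exact mem_algebraicClosure_iff.trans isAlgebraic_iff_isIntegral

theorem const_mem_constants (c : k) : C.const c ∈ C.constants :=
  C.mem_constants_iff.mpr ⟨Polynomial.X - Polynomial.C c, Polynomial.X_sub_C_ne_zero c, by simp⟩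

theorem valuation_le_one_of_mem_constants {f : C.FunctionField} (hf : f ∈ C.constants)
    (x : C.ClosedPoint) : C.valuation x f ≤ 1 := by
  obtain ⟨p, hp, hpf⟩ := C.mem_constants_iff_isIntegralElem.mp hf
  rw [valuation_le_one_iff]
  refine (IsIntegrallyClosed.isIntegral_iff (R := C.X.presheaf.stalk x.1)).mp
    ⟨p.map (C.constStalk x.1), hp.map _, ?_⟩
  rw [Polynomial.eval₂_map, ← hpf]
  congr 1
  ext c
  exact C.algebraMap_constStalk x.1 c

/-- Local representatives agree on overlaps because all have germ f at the generic point. Their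
domains cover since every nonempty closed set contains a closed point. -/
theorem exists_global_section {f : C.FunctionField} (hf : ∀ x : C.ClosedPoint,
    C.valuation x f ≤ 1) : ∃ s : Γ(C.X, ⊤), C.X.presheaf.germ ⊤ (genericPoint C.X) trivial s = f := by
  have h1 : ∀ x : C.ClosedPoint, ∃ (U : C.X.Opens) (_ : x.1 ∈ U) (hη : genericPoint C.X ∈ U)
      (s : Γ(C.X, U)), C.X.presheaf.germ U (genericPoint C.X) hη s = f := by
    intro x
    obtain ⟨a, ha⟩ := C.valuation_le_one_iff.mp (hf x)
    obtain ⟨U, hxU, s, rfl⟩ := C.X.presheaf.exists_germ_eq a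
    have : Nonempty U := ⟨⟨x.1, hxU⟩⟩
    refine ⟨U, hxU, ((genericPoint_spec C.X).mem_open_set_iff U.isOpen).mpr (by simpa), s, ?_⟩
    exact (Scheme.algebraMap_germ_eq_germToFunctionField C.X hxU s).symm.trans ha
  choose U hxU hη s hs using h1
  have hcover : (⊤ : C.X.Opens) ≤ iSup U := by
    by_contra hne
    have hne' : ((iSup U : C.X.Opens) : Set C.X)ᶜ.Nonempty := by
      rw [Set.nonempty_compl]
      intro h
      exact hne fun x _ => by
        have : x ∈ ((iSup U : C.X.Opens) : Set C.X) := h ▸ Set.mem_univ x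
        exact this
    obtain ⟨x, hx, hxc⟩ := nonempty_inter_closedPoints hne'
      (iSup U).isOpen.isClosed_compl.isLocallyClosed
    exact hx (TopologicalSpace.Opens.mem_iSup.mpr ⟨⟨x, hxc⟩, hxU ⟨x, hxc⟩⟩)
  obtain ⟨t, ht, -⟩ := C.X.sheaf.existsUnique_gluing' U ⊤ (fun i => homOfLE le_top) hcover s (by
    intro i j
    apply germ_injective_of_isIntegral (X := C.X) (genericPoint C.X) (U := U i ⊓ U j)
      ⟨hη i, hη j⟩
    refine (C.X.presheaf.germ_res_apply (TopologicalSpace.Opens.infLELeft (U i) (U j)) _ ⟨hη i, hη j⟩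
      (s i)).trans ?_
    refine Eq.trans ?_ (C.X.presheaf.germ_res_apply
      (TopologicalSpace.Opens.infLERight (U i) (U j)) _ ⟨hη i, hη j⟩ (s j)).symm
    rw [hs, hs])
  obtain ⟨x⟩ := (inferInstance : Nonempty C.ClosedPoint)
  refine ⟨t, ?_⟩
  rw [← hs x, ← ht x]
  exact (C.X.presheaf.germ_res_apply (homOfLE le_top) _ (hη x) t).symm

theorem globalConst_isIntegral : C.globalConst.IsIntegral :=
  RingHom.IsIntegral.trans _ _
    (RingHom.isIntegral_of_surjective _
      (Scheme.ΓSpecIso (CommRingCat.of k)).symm.commRingCatIsoToRingEquiv.surjective)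
    (isIntegral_appTop_of_universallyClosed C.str)

theorem mem_constants_iff_valuation_le_one {f : C.FunctionField} :
    f ∈ C.constants ↔ ∀ x : C.ClosedPoint, C.valuation x f ≤ 1 := by
  refine ⟨C.valuation_le_one_of_mem_constants, fun h => ?_⟩
  obtain ⟨s, rfl⟩ := C.exists_global_section h
  -- Properness enters here: global sections are integral over k.
  obtain ⟨p, hp, hps⟩ := C.globalConst_isIntegral s
  refine C.mem_constants_iff.mpr ⟨p, hp.ne_zero, ?_⟩
  have := congrArg (C.X.presheaf.germ ⊤ (genericPoint C.X) trivial).hom hps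
  rw [map_zero, Polynomial.hom_eval₂] at this
  exact this

theorem finite_valuation_ne_one {f : C.FunctionField} (hf : f ≠ 0) :
    {x : C.ClosedPoint | C.valuation x f ≠ 1}.Finite := by
  obtain ⟨U, hU, f', hne, hf', hunit⟩ := exists_isUnit_germ_eq C.X f hf
  refine (C.finite_closedPoint_notMem U).subset fun x hx hxU => hx ?_
  have h1 : algebraMap (C.X.presheaf.stalk x.1) C.X.functionField
      (C.X.presheaf.germ U x.1 hxU f') = f :=
    (Scheme.algebraMap_germ_eq_germToFunctionField C.X hxU f').trans hf'
  refine le_antisymm (C.valuation_le_one_iff.mpr ⟨_, h1⟩) (not_lt.mp fun h => ?_)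
  rw [← h1, valuation_algebraMap_lt_one_iff, IsLocalRing.mem_maximalIdeal] at h
  exact h (hunit.map (C.X.presheaf.germ U x.1 hxU).hom)

theorem valuation_eval₂_le_one {x : C.ClosedPoint} {f : C.FunctionField}
    (hf : C.valuation x f ≤ 1) (p : k[X]) : C.valuation x (p.eval₂ C.const f) ≤ 1 := by
  rw [Polynomial.eval₂_eq_sum, Polynomial.sum_def]
  refine Valuation.map_sum_le _ fun i _ => ?_
  rw [map_mul, map_pow]
  exact mul_le_one' (C.valuation_const_le_one x _) (pow_le_one' hf i)

theorem exists_eval₂_valuation_lt_one {x : C.ClosedPoint} {f : C.FunctionField}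
    (hf : C.valuation x f ≤ 1) :
    ∃ p : k[X], p ≠ 0 ∧ C.valuation x (p.eval₂ C.const f) < 1 := by
  obtain ⟨a, rfl⟩ := C.valuation_le_one_iff.mp hf
  obtain ⟨V, hV, hxV, g, hg, hgc⟩ := C.exists_chart x.1
  have : Nonempty V := ⟨⟨x.1, hxV⟩⟩
  algebraize [g]
  have := hV.primeIdealOf_isMaximal_of_isClosed ⟨x.1, hxV⟩ x.2
  let _ : Algebra Γ(C.X, V) (C.X.presheaf.stalk x.1) := (C.X.presheaf.germ V x.1 hxV).hom.toAlgebra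
  have : IsLocalization.AtPrime (C.X.presheaf.stalk x.1) (hV.primeIdealOf ⟨x.1, hxV⟩).asIdeal :=
    hV.isLocalization_stalk ⟨x.1, hxV⟩
  obtain ⟨p, hp, hpa⟩ := EtaleChart.exists_eval₂_mem_maximalIdeal k
    (hV.primeIdealOf ⟨x.1, hxV⟩).asIdeal (C.X.presheaf.stalk x.1) a
  refine ⟨p, hp, ?_⟩
  rw [← C.valuation_algebraMap_lt_one_iff, Polynomial.hom_eval₂] at hpa
  convert hpa using 3
  ext c
  refine (C.algebraMap_constStalk x.1 c).symm.trans (congrArg _ ?_)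
  rw [← C.germ_const hxV]
  exact congrArg _ (RingHom.congr_fun hgc c).symm

theorem exists_hasseSchmidt : ∃ Φ : C.FunctionField →+* PowerSeries C.FunctionField,
    HasseSchmidt C.valuation Φ := by
  obtain ⟨V, hV, hxV, g, hg, hgc⟩ := C.exists_chart (genericPoint C.X)
  have : Nonempty V := ⟨⟨_, hxV⟩⟩
  algebraize [g]
  have := functionField_isFractionRing_of_isAffineOpen C.X V hV
  have hconst : ∀ c, algebraMap Γ(C.X, V) C.X.functionField (g (Polynomial.C c)) = C.const c := by
    intro c
    have h1 := RingHom.congr_fun hgc c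
    rw [RingHom.comp_apply] at h1
    rw [h1]
    exact C.germ_const hxV c
  obtain ⟨Φ, hΦ, hΦt⟩ := exists_hasseSchmidt_ringHom (k := k) (A := Γ(C.X, V))
  obtain ⟨Ψ, hΨ, hΨA⟩ := exists_hasseSchmidt_extension (K := C.FunctionField) hΦ
  let τ : k[X] →+* C.FunctionField := (algebraMap Γ(C.X, V) C.X.functionField).comp g
  have hτc : τ.comp Polynomial.C = C.const := RingHom.ext hconst
  have hτ : ∀ p : k[X], Ψ (τ p) = p.eval₂ ((PowerSeries.C).comp (τ.comp Polynomial.C))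
      (PowerSeries.C (τ Polynomial.X) + PowerSeries.X) := by
    intro p
    refine (hΨA (g p)).trans ((congrArg _ (hΦt p)).trans ?_)
    rw [Polynomial.hom_eval₂]
    congr 1
    · ext c
      simp [τ, RingHom.algebraMap_toAlgebra]
    · simp [τ, RingHom.algebraMap_toAlgebra]
  refine ⟨Ψ, hΨ, fun f => ?_, ?_⟩
  · rw [← C.mem_constants_iff_valuation_le_one, C.mem_constants_iff]
    refine ⟨fun h => ?_, ?_⟩
    · obtain ⟨p, hp, hpf⟩ := EtaleChart.exists_eval₂_eq_zero (k := k) (A := Γ(C.X, V)) f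
      rw [← hτc]
      exact exists_eval₂_eq_zero_of_hasseSchmidt_eq_C τ hτ h hp hpf
    · rintro ⟨m, hm, hmf⟩
      refine hasseSchmidt_eq_C_of_isAlgebraic hΨ C.const (fun c => ?_) hm hmf
      have := hτ (Polynomial.C c)
      rw [Polynomial.eval₂_C] at this
      rw [← hτc]
      exact this
  -- Only points outside the chart can be bad: inside it the local ring is a localization of the
  -- coordinate ring.
  · refine (C.finite_closedPoint_notMem V).subset fun x hx hxV' => hx fun f hf n => ?_
    obtain ⟨a, rfl⟩ := C.valuation_le_one_iff.mp hf
    let _ : Algebra Γ(C.X, V) (C.X.presheaf.stalk x.1) :=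
      (C.X.presheaf.germ V x.1 hxV').hom.toAlgebra
    have hloc : IsLocalization.AtPrime (C.X.presheaf.stalk x.1)
        (hV.primeIdealOf ⟨x.1, hxV'⟩).asIdeal := hV.isLocalization_stalk ⟨x.1, hxV'⟩
    have hmap : ∀ b : Γ(C.X, V), algebraMap (C.X.presheaf.stalk x.1) C.X.functionField
        (algebraMap _ (C.X.presheaf.stalk x.1) b) = algebraMap _ C.X.functionField b := fun b =>
      Scheme.algebraMap_germ_eq_germToFunctionField C.X hxV' b
    obtain ⟨⟨b, s⟩, hbs⟩ :=
      IsLocalization.surj (hV.primeIdealOf ⟨x.1, hxV'⟩).asIdeal.primeCompl a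
    have hs : C.valuation x (algebraMap Γ(C.X, V) C.X.functionField s) = 1 := by
      refine le_antisymm (C.valuation_le_one_iff.mpr ⟨_, hmap s⟩) (not_lt.mp fun h => ?_)
      rw [← hmap, valuation_algebraMap_lt_one_iff, IsLocalRing.mem_maximalIdeal] at h
      exact h (IsLocalization.map_units _ s)
    have hs0 : algebraMap Γ(C.X, V) C.X.functionField s ≠ 0 := by
      intro h; simp [h] at hs
    have ha : algebraMap (C.X.presheaf.stalk x.1) C.X.functionField a =
        algebraMap Γ(C.X, V) C.X.functionField b / algebraMap Γ(C.X, V) C.X.functionField s := by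
      rw [eq_div_iff hs0, ← hmap, ← hmap, ← map_mul, hbs]
    rw [ha]
    exact coeff_le_one_of_localization hΨ hΨA (C.valuation x)
      (fun b => C.valuation_le_one_iff.mpr ⟨_, hmap b⟩) hs n

theorem constants_ne_top : C.constants ≠ ⊤ := by
  intro h
  obtain ⟨x⟩ := (inferInstance : Nonempty C.ClosedPoint)
  obtain ⟨π, hπ⟩ := IsDiscreteValuationRing.exists_irreducible (C.X.presheaf.stalk x.1)
  have h1 : C.valuation x (algebraMap (C.X.presheaf.stalk x.1) C.X.functionField π) < 1 :=
    C.valuation_algebraMap_lt_one_iff.mpr ((IsLocalRing.mem_maximalIdeal _).mpr hπ.not_isUnit)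
  have h0 : algebraMap (C.X.presheaf.stalk x.1) C.X.functionField π ≠ 0 := fun h' =>
    hπ.ne_zero (IsFractionRing.injective _ C.X.functionField (by simpa using h'))
  refine (not_inv_le_one_iff _ h0).mpr h1 (C.valuation_le_one_of_mem_constants ?_ x)
  rw [h]
  trivial

end Curve
end AnabelianCurve

/-! ### Values and rational points -/

namespace AnabelianCurve

open AlgebraicGeometry CategoryTheory
open scoped Polynomial nonZeroDivisors WithZero

namespace Curve

variable {k : Type u} [Field k] (C : Curve k)

theorem value_algebraMap (x : C.ClosedPoint) (a : C.X.presheaf.stalk x.1) :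
    C.value x (algebraMap (C.X.presheaf.stalk x.1) C.X.functionField a) =
      (C.X.residue x.1).hom a := by
  have h : ∃ b : C.X.presheaf.stalk x.1, algebraMap (C.X.presheaf.stalk x.1) C.X.functionField b =
      algebraMap (C.X.presheaf.stalk x.1) C.X.functionField a := ⟨a, rfl⟩
  rw [value, dif_pos h]
  exact congrArg _ (IsFractionRing.injective _ C.X.functionField h.choose_spec)

theorem value_ne_zero {x : C.ClosedPoint} {f : C.FunctionField} (hf : C.valuation x f = 1) :
    C.value x f ≠ 0 := by
  obtain ⟨a, rfl⟩ := C.valuation_le_one_iff.mp hf.le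
  rw [value_algebraMap]
  intro h
  have : a ∈ IsLocalRing.maximalIdeal (C.X.presheaf.stalk x.1) :=
    (IsLocalRing.residue_eq_zero_iff a).mp h
  exact (C.valuation_algebraMap_lt_one_iff.mpr this).ne hf

theorem value_eq_one_iff {x : C.ClosedPoint} {f : C.FunctionField} (hf : C.valuation x f = 1) :
    C.value x f = 1 ↔ C.valuation x (f - 1) < 1 := by
  obtain ⟨a, rfl⟩ := C.valuation_le_one_iff.mp hf.le
  have e : algebraMap (C.X.presheaf.stalk x.1) C.X.functionField a - 1 =
      algebraMap (C.X.presheaf.stalk x.1) C.X.functionField (a - 1) := by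
    rw [map_sub, map_one]
  rw [value_algebraMap, e, valuation_algebraMap_lt_one_iff, ← IsLocalRing.residue_eq_zero_iff,
    map_sub, map_one, sub_eq_zero]
  rfl

/-- A rational point gives a retraction of the local ring onto the base field, which determines
the point. -/
theorem exists_retraction (p : C.RationalPoint) (x : C.X)
    (hx : p.1 (IsLocalRing.closedPoint k) = x) :
    ∃ ψ : C.X.presheaf.stalk x ⟶ CommRingCat.of k, IsLocalHom ψ.hom ∧
      Spec.map ψ ≫ C.X.fromSpecStalk x = p.1 ∧ ∀ c, ψ.hom (C.constStalk x c) = c := by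
  subst hx
  refine ⟨Scheme.stalkClosedPointTo p.1, inferInstance,
    Scheme.Spec_stalkClosedPointTo_fromSpecStalk p.1, fun c => ?_⟩
  have h1 := Scheme.germ_stalkClosedPointTo p.1 ⊤ trivial
  have h2 : C.str.appTop ≫ C.X.presheaf.germ ⊤ (p.1 (IsLocalRing.closedPoint k)) trivial ≫
      Scheme.stalkClosedPointTo p.1 = (Scheme.ΓSpecIso (CommRingCat.of k)).hom := by
    rw [h1]
    have h3 : C.str.appTop ≫ p.1.appTop = 𝟙 _ := by
      rw [← Scheme.Hom.comp_appTop, p.2, Scheme.Hom.id_appTop]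
    exact (reassoc_of% h3) _
  have h4 : (Scheme.ΓSpecIso (CommRingCat.of k)).inv ≫ C.str.appTop ≫
      C.X.presheaf.germ ⊤ (p.1 (IsLocalRing.closedPoint k)) trivial ≫
      Scheme.stalkClosedPointTo p.1 = 𝟙 _ := by
    rw [h2, Iso.inv_hom_id]
  exact RingHom.congr_fun (congrArg CommRingCat.Hom.hom h4) c

theorem sub_constStalk_mem {x : C.X} {ψ : C.X.presheaf.stalk x ⟶ CommRingCat.of k}
    (hψ : ∀ c, ψ.hom (C.constStalk x c) = c) (a : C.X.presheaf.stalk x) :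
    a - C.constStalk x (ψ.hom a) ∈ IsLocalRing.maximalIdeal (C.X.presheaf.stalk x) := by
  rw [IsLocalRing.mem_maximalIdeal, mem_nonunits_iff]
  intro h
  have := h.map ψ.hom
  rw [map_sub, hψ, sub_self] at this
  exact not_isUnit_zero this

/-- The closed point underlying a rational point. -/
noncomputable def RationalPoint.toClosedPoint {C : Curve k} (p : C.RationalPoint) : C.ClosedPoint :=
  ⟨p.1 (IsLocalRing.closedPoint k), by
    have := isClosedImmersion_of_comp_eq_id _ _ p.2
    have := p.1.isClosedEmbedding.isClosed_range
    rwa [Set.range_eq_singleton] at this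
    exact fun x => congrArg p.1 (Subsingleton.elim (α := PrimeSpectrum k) _ _)⟩

/-- A local retraction of the stalk onto k kills the maximal ideal and fixes k, so the point
determines it. -/
theorem RationalPoint.toClosedPoint_injective :
    Function.Injective (RationalPoint.toClosedPoint (C := C)) := by
  intro p p' h
  obtain ⟨ψ, hloc, hp, hψ⟩ := C.exists_retraction p p.toClosedPoint.1 rfl
  obtain ⟨ψ', hloc', hp', hψ'⟩ := C.exists_retraction p' p.toClosedPoint.1 (congrArg Subtype.val h).symm
  apply Subtype.ext
  rw [← hp, ← hp']
  congr 2
  ext a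
  have h1 := C.sub_constStalk_mem hψ a
  have h2 : ψ'.hom (a - C.constStalk _ (ψ.hom a)) = 0 := by
    by_contra hne
    exact (IsLocalRing.mem_maximalIdeal _).mp h1
      (isUnit_of_map_unit ψ'.hom _ (isUnit_iff_ne_zero.mpr hne))
  rw [map_sub, hψ', sub_eq_zero] at h2
  exact h2.symm

/-- For k finite and f nonconstant, every rational point is a zero or pole of f or a zero of f - c
with c in k, and these are finite in number. -/
theorem infinite_of_infinite_rationalPoint [Infinite C.RationalPoint] : Infinite k := by
  by_contra hk
  have : Finite k := not_infinite_iff_finite.mp hk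
  obtain ⟨f, hf⟩ : ∃ f, f ∉ C.constants := by
    by_contra! h
    exact C.constants_ne_top (eq_top_iff.mpr fun x _ => h x)
  have hne : ∀ c, f - C.const c ≠ 0 := fun c h =>
    hf (sub_eq_zero.mp h ▸ C.const_mem_constants c)
  have hf0 : f ≠ 0 := fun h => hf (h ▸ C.constants.zero_mem)
  have hfin := (C.finite_valuation_ne_one hf0).union
    (Set.finite_iUnion fun c : k => C.finite_valuation_ne_one (hne c))
  refine Set.infinite_range_of_injective (RationalPoint.toClosedPoint_injective C)
    (hfin.subset ?_)
  rintro _ ⟨p, rfl⟩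
  by_cases h1 : C.valuation p.toClosedPoint f = 1
  · right
    obtain ⟨a, ha⟩ := C.valuation_le_one_iff.mp h1.le
    obtain ⟨ψ, -, -, hψ⟩ := C.exists_retraction p p.toClosedPoint.1 rfl
    refine Set.mem_iUnion.mpr ⟨ψ.hom a, ne_of_lt ?_⟩
    have h2 := C.valuation_algebraMap_lt_one_iff.mpr (C.sub_constStalk_mem hψ a)
    rw [map_sub, ha] at h2
    rwa [C.algebraMap_constStalk] at h2
  · exact Or.inl h1

end Curve

/-! ### Curves satisfy the abstract hypotheses -/

/-- The extension by zero of a homomorphism of unit groups, as a homomorphism of monoids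
with zero. -/
noncomputable def extendByZeroHom {K₂ : Type v} {K₁ : Type u} [Field K₂] [Field K₁]
    (ι : K₂ˣ →* K₁ˣ) : K₂ →*₀ K₁ where
  toFun := extendByZero ι
  map_zero' := by simp [extendByZero]
  map_one' := by
    rw [extendByZero, dif_neg one_ne_zero]
    simp
  map_mul' x y := by
    rcases eq_or_ne x 0 with rfl | hx
    · simp [extendByZero]
    rcases eq_or_ne y 0 with rfl | hy
    · simp [extendByZero]
    rw [extendByZero, extendByZero, extendByZero, dif_neg hx, dif_neg hy,
      dif_neg (mul_ne_zero hx hy), ← Units.val_mul, ← map_mul, Units.mk0_mul]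

theorem extendByZeroHom_coe {K₂ : Type v} {K₁ : Type u} [Field K₂] [Field K₁]
    (ι : K₂ˣ →* K₁ˣ) (f : K₂ˣ) : extendByZeroHom ι f = ι f := by
  change extendByZero ι f = _
  rw [extendByZero, dif_neg f.ne_zero]
  simp

theorem extendByZeroHom_injective {K₂ : Type v} {K₁ : Type u} [Field K₂] [Field K₁]
    {ι : K₂ˣ →* K₁ˣ} (hι : Function.Injective ι) : Function.Injective (extendByZeroHom ι) := by
  intro x y h
  rcases eq_or_ne y 0 with rfl | hy
  · simpa using h
  rcases eq_or_ne x 0 with rfl | hx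
  · exact ((map_eq_zero (extendByZeroHom ι)).mp (h.symm.trans (map_zero _))).symm
  lift x to K₂ˣ using isUnit_iff_ne_zero.mpr hx
  lift y to K₂ˣ using isUnit_iff_ne_zero.mpr hy
  rw [extendByZeroHom_coe, extendByZeroHom_coe] at h
  rw [hι (Units.ext h)]

theorem valuation_eq_one_of_sub_one_lt {K : Type*} [Field K] (v : Valuation K ℤᵐ⁰) {x : K}
    (h : v (x - 1) < 1) : v x = 1 := by
  have := Valuation.map_one_add_of_lt (v := v) h
  rwa [add_sub_cancel] at this

theorem placeCompatible_extendByZeroHom {k₁ : Type u} [Field k₁] {k₂ : Type v} [Field k₂]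
    {X₁ : Curve k₁} {X₂ : Curve k₂} {ι : X₂.FunctionFieldˣ →* X₁.FunctionFieldˣ}
    {φ : X₁.ClosedPoint → X₂.ClosedPoint}
    {r : ∀ x₁ : X₁.ClosedPoint, (X₂.ResidueField (φ x₁))ˣ →* (X₁.ResidueField x₁)ˣ}
    (hr : ∀ x₁ : X₁.ClosedPoint, Function.Injective (r x₁))
    (hord : OrderPreserving ι φ) (hval : ValuePreserving ι φ r) :
    PlaceCompatible X₁.valuation (fun x₁ => X₂.valuation (φ x₁)) X₂.constants
      (extendByZeroHom ι) where
  map_le q x := by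
    rcases eq_or_ne x 0 with rfl | hx
    · simp
    lift x to X₂.FunctionFieldˣ using isUnit_iff_ne_zero.mpr hx
    obtain ⟨e, he, h⟩ := hord q
    rw [extendByZeroHom_coe, Curve.valuation_eq_exp, Curve.valuation_eq_exp, h, ← WithZero.exp_zero,
      WithZero.exp_le_exp, WithZero.exp_le_exp]
    simp [mul_nonneg_iff_of_pos_left he]
  map_sub_one_lt q x := by
    rcases eq_or_ne x 0 with rfl | hx
    · simp
    lift x to X₂.FunctionFieldˣ using isUnit_iff_ne_zero.mpr hx
    obtain ⟨e, he, h⟩ := hord q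
    rw [extendByZeroHom_coe]
    -- For a unit x, value preservation and injectivity of `r q` compare the values with 1;
    -- otherwise neither x nor ι x has order zero, so both sides fail.
    by_cases h0 : X₂.ord (φ q) x = 0
    · have h2 : X₂.valuation (φ q) x = 1 := by rw [Curve.valuation_eq_exp, h0]; simp
      have h1 : X₁.valuation q (ι x) = 1 := by rw [Curve.valuation_eq_exp, h, h0]; simp
      have hne := X₂.value_ne_zero h2
      have hv := hval x q h0 hne
      rw [← X₁.value_eq_one_iff h1, ← X₂.value_eq_one_iff h2, ← hv, Units.val_eq_one,
        map_eq_one_iff _ (hr q), ← Units.val_eq_one, Units.val_mk0]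
    · refine iff_of_false (fun hlt => ?_) fun hlt => ?_
      · have := valuation_eq_one_of_sub_one_lt _ hlt
        rw [Curve.valuation_eq_exp, h, ← WithZero.exp_zero, WithZero.exp_inj] at this
        simp [he.ne', h0] at this
      · have := valuation_eq_one_of_sub_one_lt _ hlt
        rw [Curve.valuation_eq_exp, ← WithZero.exp_zero, WithZero.exp_inj] at this
        simp [h0] at this
  const_le x hx q := X₂.valuation_le_one_of_mem_constants hx (φ q)
  exists_zero q x hx hle := by
    obtain ⟨p, hp, hlt⟩ := X₂.exists_eval₂_valuation_lt_one hle
    refine ⟨_, fun h => hx (X₂.mem_constants_iff.mpr ⟨p, hp, h⟩), hlt, fun q' h =>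
      X₂.valuation_eval₂_le_one h p⟩
  inv_const x hx := by
    rw [← X₁.mem_constants_iff_valuation_le_one] at hx ⊢
    exact X₁.constants.inv_mem hx
  finite_ne_one x hx := X₁.finite_valuation_ne_one hx

end AnabelianCurve

theorem proposition5p3 {k₁ : Type u} [Field k₁] {k₂ : Type v} [Field k₂]
    (X₁ : AnabelianCurve.Curve k₁) (X₂ : AnabelianCurve.Curve k₂)
    (ι : X₂.FunctionFieldˣ →* X₁.FunctionFieldˣ) (hι : Function.Injective ι)
    (φ : X₁.ClosedPoint → X₂.ClosedPoint)
    (hφ : ∀ x₂ : X₂.ClosedPoint, (φ ⁻¹' {x₂}).Finite)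
    (r : ∀ x₁ : X₁.ClosedPoint, (X₂.ResidueField (φ x₁))ˣ →* (X₁.ResidueField x₁)ˣ)
    (hr : ∀ x₁ : X₁.ClosedPoint, Function.Injective (r x₁))
    (hord : AnabelianCurve.OrderPreserving ι φ)
    (hval : AnabelianCurve.ValuePreserving ι φ r)
    (hX₂ : Infinite X₂.RationalPoint) :
    (∀ f g : X₂.FunctionField,
      AnabelianCurve.extendByZero ι (f + g) =
        AnabelianCurve.extendByZero ι f + AnabelianCurve.extendByZero ι g) ∧
    ∃ F : X₂.FunctionField →+* X₁.FunctionField,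
      ∀ f : X₂.FunctionField, F f = AnabelianCurve.extendByZero ι f := by
  have : Infinite k₂ := X₂.infinite_of_infinite_rationalPoint
  have : Infinite X₂.constants :=
    Infinite.of_injective (fun c => (⟨X₂.const c, X₂.const_mem_constants c⟩ : X₂.constants))
      fun c d h => X₂.const.injective (congrArg Subtype.val h)
  obtain ⟨Φ, hΦ⟩ := X₁.exists_hasseSchmidt
  have hadd := (AnabelianCurve.placeCompatible_extendByZeroHom hr hord hval).map_add
    (AnabelianCurve.extendByZeroHom_injective hι) hΦ X₂.constants_ne_top
  exact ⟨hadd, { AnabelianCurve.extendByZeroHom ι with map_add' := hadd }, fun _ => rfl⟩
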